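/- Let $K$ be a field that is complete with respect to a nontrivial non-Archimedean absolute value $|\cdot|$. Let $x_0\in K$ and let $f(x)=x_0+\lambda(x-x_0)+O((x-x_0)^2)\in K[[x-x_0]]$ be a power series such that $|\lambda|=1$ and $\lambda$ is not a root of unity. Suppose that $f$ has a linearization disc $\Delta_f(x_0)$: the largest disc $U\subseteq K$ containing $x_0$ (open or closed of positive radius, or $U=K$) such that the power series solution $g_1$, with $g_1(x_0)=0$ and $g_1'(x_0)=1$, of the Schröder functional equation $g_1(f(x))=\lambda g_1(x)$ converges and is one-to-one on $U$, and the equation holds for all $x\in U$. Let $g\in K[[x-x_0]]$, with $g(x_0)=0$ and $|g'(x_0)|=1$, be a conjugacy function on $\Delta_f(x_0)$, that is, $g$ converges and is one-to-one on $\Delta_f(x_0)$ and $g(f(x))=\lambda g(x)$ for all $x\in\Delta_f(x_0)$. Let $T_\lambda$ denote the map $x\mapsto\lambda x$. Let $X\subseteq\Delta_f(x_0)$ be non-empty, compact and invariant under $f$, i.e. $f(X)\subseteq X$. Then the following statements are equivalent: 1. $T_\lambda:g(X)\to g(X)$ is minimal. 2. $f:X\to X$ is minimal. 3. $f:X\to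 X$ is uniquely ergodic. 4. $f:X\to X$ is ergodic for every finite $f$-invariant measure $\mu$ on the Borel $\sigma$-algebra $\mathcal B(X)$ that is positive on non-empty open sets. Here a map is minimal if every forward orbit is dense; it is uniquely ergodic if it has exactly one invariant Borel probability measure; and it is ergodic for an invariant measure $\mu$ if $\mu(A)\mu(A^c)=0$ for every Borel set $A$ whose preimage is $A$. -/

import Mathlib

namespace NonArchDynamics

open Set MeasureTheory

section Series

variable {K : Type*} [NontriviallyNormedField K]

/-- The power series `∑ aₙ (X - c)ⁿ` with coefficients `aₙ` converges at the point `x`. (Over a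
complete non-Archimedean field, summability is the same as convergence of the partial sums.) -/
def ConvergesAt (F : PowerSeries K) (c x : K) : Prop :=
  Summable fun n : ℕ => PowerSeries.coeff n F * (x - c) ^ n

/-- The value at `x` of the power series `∑ aₙ (X - c)ⁿ`; meaningful where `ConvergesAt F c x`. -/
noncomputable def value (F : PowerSeries K) (c x : K) : K :=
  ∑' n : ℕ, PowerSeries.coeff n F * (x - c) ^ n

/-- Discs of `K`: the open and the closed discs of positive radius; the whole field counts as the
disc of infinite radius. -/
def IsDisc (U : Set K) : Prop :=
  U = univ ∨ ∃ (c : K) (r : ℝ), 0 < r ∧ (U = Metric.ball c r ∨ U = Metric.closedBall c r)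

/-- The series `f`, in powers of `X - x₀`, has at `x₀` an indifferent fixed point, whose multiplier
(the coefficient of `X - x₀`) is not a root of unity. -/
structure IsIndifferentNonresonant (f : PowerSeries K) (x₀ : K) : Prop where
  fixed : PowerSeries.coeff 0 f = x₀
  indifferent : ‖PowerSeries.coeff 1 f‖ = 1
  nonresonant : ∀ n : ℕ, 0 < n → PowerSeries.coeff 1 f ^ n ≠ 1

/-- On `U`, the series `g` (in powers of `X - x₀`) converges, is one-to-one, and satisfies the
Schröder functional equation `g (f x) = λ g x`, where `λ` is the multiplier of `f` at `x₀`. -/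
structure ConjugatesOn (f g : PowerSeries K) (x₀ : K) (U : Set K) : Prop where
  conv_f : ∀ x ∈ U, ConvergesAt f x₀ x
  conv_g : ∀ x ∈ U, ConvergesAt g x₀ x
  conv_gf : ∀ x ∈ U, ConvergesAt g x₀ (value f x₀ x)
  schroeder : ∀ x ∈ U,
    value g x₀ (value f x₀ x) = PowerSeries.coeff 1 f * value g x₀ x
  injOn : InjOn (value g x₀) U

/-- `D` is the linearization disc of `f` about the indifferent, nonresonant fixed point `x₀`: the
largest disc containing `x₀` on which the solution `g` of the Schröder functional equation with
`g x₀ = 0` and `g' x₀ = 1` converges, is one-to-one, and satisfies that equation. -/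
def IsLinearizationDisc (f : PowerSeries K) (x₀ : K) (D : Set K) : Prop :=
  IsIndifferentNonresonant f x₀ ∧
    ∃ g : PowerSeries K, PowerSeries.coeff 0 g = 0 ∧ PowerSeries.coeff 1 g = 1 ∧
      IsGreatest {U : Set K | IsDisc U ∧ x₀ ∈ U ∧ ConjugatesOn f g x₀ U} D

/-- If `X` is `f`-invariant, then `g(X)` is invariant under multiplication by the multiplier, so
that the latter restricts to a self-map of `g(X)`. -/
theorem ConjugatesOn.mapsTo_mul {f g : PowerSeries K} {x₀ : K} {D X : Set K}
    (h : ConjugatesOn f g x₀ D) (hXD : X ⊆ D) (hX : MapsTo (value f x₀) X X) :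
    MapsTo (fun y : K => PowerSeries.coeff 1 f * y) (value g x₀ '' X) (value g x₀ '' X) := by
  rintro _ ⟨x, hx, rfl⟩
  exact ⟨value f x₀ x, hX hx, h.schroeder x (hXD hx)⟩

end Series

section Dynamics

variable {Y : Type*} [TopologicalSpace Y]

/-- A self-map is minimal if every forward orbit is dense. -/
def IsMinimalMap (T : Y → Y) : Prop :=
  ∀ y : Y, Dense (range fun n : ℕ => T^[n] y)

/-- A self-map is uniquely ergodic if it has exactly one invariant Borel probability measure. -/
def IsUniquelyErgodic [MeasurableSpace Y] [BorelSpace Y] (T : Y → Y) : Prop :=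
  ∃! μ : Measure Y, IsProbabilityMeasure μ ∧ MeasurePreserving T μ μ

end Dynamics

end NonArchDynamics

/-! Since `g` is one-to-one and the multiplier has absolute value 1, `f` is an isometry of `X` for
the ultrametric pulled back along `g`; compactness of `X` makes `g` an embedding, so this metric
induces the given topology. The rest concerns an isometry `T` of a compact ultrametric space.
Minimal implies uniquely ergodic: an invariant measure gives equal mass to all balls of one radius,
and Fubini shows that two invariant probabilities agree on balls (`IsMinimalMap.measure_ball_eq`).
Unique ergodicity implies ergodicity, as an invariant set splitting the measure yields two invariant
probabilities. Ergodic implies minimal: the distance to an orbit closure is an invariant function,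
and it is nonconstant unless the orbit is dense; an invariant measure of full support detects this.
-/

namespace NonArchDynamics

open Set MeasureTheory Filter Topology Function

/-! ### Minimality, orbit closures and ergodicity for general maps. -/

section Topological

variable {Y Z : Type*} [TopologicalSpace Y] [TopologicalSpace Z] {T : Y → Y} {S : Z → Z}

/-- Minimality passes to continuous factors. -/
theorem IsMinimalMap.of_semiconj (hT : IsMinimalMap T) {p : Y → Z} (hp : Continuous p)
    (hsurj : Surjective p) (h : Semiconj p T S) : IsMinimalMap S := by
  intro z
  obtain ⟨y, rfl⟩ := hsurj z
  have := hsurj.denseRange.dense_image hp (hT y)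
  rw [← range_comp] at this
  refine this.mono (range_subset_iff.2 fun n => ⟨n, ?_⟩)
  exact ((h.iterate_right n).eq y).symm

/-- A nonzero measure invariant under a minimal map charges every nonempty open set. -/
theorem IsMinimalMap.measure_pos [MeasurableSpace Y] [BorelSpace Y] (hT : IsMinimalMap T)
    {μ : Measure Y} (hμ : MeasurePreserving T μ μ) (h0 : μ ≠ 0) {U : Set Y} (hU : IsOpen U)
    (hne : U.Nonempty) : 0 < μ U := by
  rw [pos_iff_ne_zero]
  intro h
  apply h0
  rw [← Measure.measure_univ_eq_zero]
  have hcov : (univ : Set Y) ⊆ ⋃ n : ℕ, T^[n] ⁻¹' U := by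
    intro y _
    obtain ⟨_, hu, n, rfl⟩ := (hT y).inter_open_nonempty U hU hne
    exact mem_iUnion.2 ⟨n, hu⟩
  refine measure_mono_null hcov (measure_iUnion_null fun n => ?_)
  rw [(hμ.iterate n).measure_preimage hU.nullMeasurableSet, h]

/-- The closure of the forward orbit of `x`. -/
def orbitClosure (T : Y → Y) (x : Y) : Set Y := closure (range fun n : ℕ => T^[n] x)

theorem self_mem_orbitClosure (x : Y) : x ∈ orbitClosure T x :=
  subset_closure ⟨0, rfl⟩

theorem mapsTo_orbitClosure (hT : Continuous T) (x : Y) :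
    MapsTo T (orbitClosure T x) (orbitClosure T x) := by
  refine MapsTo.closure ?_ hT
  rintro _ ⟨n, rfl⟩
  exact ⟨n + 1, iterate_succ_apply' T n x⟩

theorem orbitClosure_subset (hT : Continuous T) {x y : Y} (h : y ∈ orbitClosure T x) :
    orbitClosure T y ⊆ orbitClosure T x :=
  closure_minimal (range_subset_iff.2 fun n => (mapsTo_orbitClosure hT x).iterate n h)
    isClosed_closure

/-- A uniquely ergodic map is ergodic for each of its finite invariant measures. -/
theorem IsUniquelyErgodic.ergodic [MeasurableSpace Y] [BorelSpace Y] (hT : IsUniquelyErgodic T)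
    {μ : Measure Y} [IsFiniteMeasure μ] (hμ : MeasurePreserving T μ μ) : Ergodic T μ := by
  refine ⟨hμ, ⟨fun A hA hinv => ?_⟩⟩
  rw [eventuallyConst_set', ae_eq_empty, ae_eq_univ]
  by_contra! hne
  -- The normalised restrictions to `A` and `Aᶜ` are both invariant, hence equal; evaluating at `A`
  -- gives 1 = 0.
  have key : ∀ B : Set Y, MeasurableSet B → T ⁻¹' B = B → μ B ≠ 0 →
      IsProbabilityMeasure ((μ B)⁻¹ • μ.restrict B) ∧
        MeasurePreserving T ((μ B)⁻¹ • μ.restrict B) ((μ B)⁻¹ • μ.restrict B) := by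
    intro B hB hinvB h0
    refine ⟨⟨?_⟩, ?_⟩
    · simpa using ENNReal.inv_mul_cancel h0 (measure_ne_top μ B)
    · have := hμ.restrict_preimage hB
      rw [hinvB] at this
      exact this.smul_measure _
  have heq := hT.unique (key A hA hinv hne.1) (key Aᶜ hA.compl (by rw [preimage_compl, hinv]) hne.2)
  have h1 := congrArg (fun m : Measure Y => m A) heq
  simp only [Measure.smul_apply, smul_eq_mul, Measure.restrict_apply hA, inter_self,
    inter_compl_self, measure_empty, mul_zero] at h1
  rw [ENNReal.inv_mul_cancel hne.1 (measure_ne_top μ A)] at h1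
  exact one_ne_zero h1

end Topological

/-! ### Invariant measures and isometries on compact metric spaces. -/

theorem _root_.Isometry.iterate {Y : Type*} [PseudoEMetricSpace Y] {T : Y → Y} (hT : Isometry T) :
    ∀ n : ℕ, Isometry T^[n]
  | 0 => isometry_id
  | n + 1 => (hT.iterate n).comp hT

section Compact

variable {Y : Type*} [MetricSpace Y] [CompactSpace Y] {T : Y → Y}

/-- **Krylov–Bogolyubov**: a continuous self-map of a nonempty compact metric space has an
invariant Borel probability measure. -/
theorem exists_isProbabilityMeasure_measurePreserving [MeasurableSpace Y] [BorelSpace Y]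
    [Nonempty Y] (hT : Continuous T) :
    ∃ μ : Measure Y, IsProbabilityMeasure μ ∧ MeasurePreserving T μ μ := by
  obtain ⟨x⟩ := ‹Nonempty Y›
  let ν : ℕ → Measure Y := fun n =>
    ((n : ENNReal) + 1)⁻¹ • ∑ k ∈ Finset.range (n + 1), Measure.dirac (T^[k] x)
  have hν : ∀ n, IsProbabilityMeasure (ν n) := fun n => ⟨by
    simp only [ν, Measure.smul_apply, Measure.finsetSum_apply, measure_univ, Finset.sum_const,
      Finset.card_range, smul_eq_mul, nsmul_eq_mul, mul_one]
    push_cast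
    exact ENNReal.inv_mul_cancel (by simp) (by simp)⟩
  have hint : ∀ (n : ℕ) (h : BoundedContinuousFunction Y ℝ),
      ∫ y, h y ∂(ν n) = birkhoffAverage ℝ T h (n + 1) x := by
    intro n h
    simp only [ν]
    rw [integral_smul_measure, integral_finsetSum_measure (fun k _ => integrable_dirac (by simp))]
    simp only [integral_dirac, birkhoffAverage, birkhoffSum]
    congr 1
    rw [ENNReal.toReal_inv, ENNReal.toReal_add (by simp) (by simp)]
    simp
  let P : ℕ → ProbabilityMeasure Y := fun n => ⟨ν n, hν n⟩
  -- Along an ultrafilter a cluster point is a limit, so no subsequence is needed.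
  obtain ⟨μ, hμ⟩ := exists_clusterPt_of_compactSpace (map P (hyperfilter ℕ : Filter ℕ))
  have hlim : Tendsto P (hyperfilter ℕ : Filter ℕ) (𝓝 μ) := by
    have : (Ultrafilter.map P (hyperfilter ℕ) : Filter (ProbabilityMeasure Y)) ≤ 𝓝 μ :=
      Ultrafilter.clusterPt_iff.1 hμ
    exact this
  rw [ProbabilityMeasure.tendsto_iff_forall_integral_tendsto] at hlim
  refine ⟨μ, inferInstance, hT.measurable, ?_⟩
  have : IsProbabilityMeasure (Measure.map T (μ : Measure Y)) :=
    Measure.isProbabilityMeasure_map hT.measurable.aemeasurable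
  refine ext_of_forall_integral_eq_of_IsFiniteMeasure fun h => ?_
  rw [integral_map hT.measurable.aemeasurable h.continuous.aestronglyMeasurable]
  have h1 := hlim (h.compContinuous ⟨T, hT⟩)
  have h2 := hlim h
  have h3 : Tendsto (fun n : ℕ => birkhoffAverage ℝ T h (n + 1) (T x)
      - birkhoffAverage ℝ T h (n + 1) x) (hyperfilter ℕ : Filter ℕ) (𝓝 0) :=
    ((tendsto_birkhoffAverage_apply_sub_birkhoffAverage' ℝ (h.isBounded_range) T x).comp
      (tendsto_add_atTop_nat 1)).mono_left (Nat.hyperfilter_le_atTop)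
  have h4 := h1.sub h2
  refine sub_eq_zero.1 (tendsto_nhds_unique (h4.congr fun n => ?_) h3)
  simp only [P, ProbabilityMeasure.coe_mk, hint]
  congr 1
  simp only [birkhoffAverage, birkhoffSum, BoundedContinuousFunction.compContinuous_apply,
    ContinuousMap.coe_mk, ← iterate_succ_apply, ← iterate_succ_apply']

/-- Every point of a compact metric space is recurrent under an isometry. -/
theorem _root_.Isometry.frequently_dist_iterate_lt (hT : Isometry T) (x : Y) {ε : ℝ} (hε : 0 < ε) :
    ∃ᶠ n in atTop, dist (T^[n] x) x < ε := by
  obtain ⟨_, φ, hφ, hlim⟩ := CompactSpace.tendsto_subseq fun n => T^[n] x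
  obtain ⟨M, hM⟩ := Metric.cauchySeq_iff.1 hlim.cauchySeq ε hε
  refine frequently_atTop.2 fun N => ?_
  -- The index is taken so large that the return time, a difference of two values of `φ`, is at
  -- least `N`.
  have hle : φ M + N ≤ φ (M + (φ M + N)) :=
    (Nat.le_add_left _ _).trans (hφ.id_le _)
  refine ⟨φ (M + (φ M + N)) - φ M, by omega, ?_⟩
  have := hM (M + (φ M + N)) (Nat.le_add_right _ _) M le_rfl
  rw [← (hT.iterate (φ M)).dist_eq, ← iterate_add_apply]
  rwa [Nat.add_sub_of_le (by omega)]

/-- If `T^[k] x` is near `y` and `T^[m] x` has returned near `x` with `m ≥ k`, then `T^[m - k] y` is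
near `x`. -/
theorem mem_orbitClosure_symm (hT : Isometry T) {x y : Y} (h : y ∈ orbitClosure T x) :
    x ∈ orbitClosure T y := by
  refine Metric.mem_closure_range_iff.2 fun ε hε => ?_
  obtain ⟨k, hk⟩ := Metric.mem_closure_range_iff.1 h (ε / 2) (half_pos hε)
  obtain ⟨m, hm, hkm⟩ := ((hT.frequently_dist_iterate_lt x (half_pos hε)).and_eventually
    (eventually_ge_atTop k)).exists
  refine ⟨m - k, ?_⟩
  have h1 : dist (T^[m] x) (T^[m - k] y) = dist y (T^[k] x) := by
    rw [dist_comm y, ← (hT.iterate (m - k)).dist_eq (T^[k] x), ← iterate_add_apply,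
      Nat.sub_add_cancel hkm]
  have := dist_triangle x (T^[m] x) (T^[m - k] y)
  rw [dist_comm x (T^[m] x), h1] at this
  linarith

/-- An isometry of a compact space is minimal on each orbit closure. -/
theorem isMinimalMap_restrict_orbitClosure (hT : Isometry T) (x : Y) :
    IsMinimalMap (MapsTo.restrict T _ _ (mapsTo_orbitClosure hT.continuous x)) := by
  rintro ⟨y, hy⟩ ⟨z, hz⟩
  rw [closure_subtype, ← range_comp]
  simp only [MapsTo.iterate_restrict]
  exact orbitClosure_subset hT.continuous (mem_orbitClosure_symm hT hy) hz

/-- The distance to an orbit closure is invariant under an isometry of a compact space. -/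
theorem infDist_orbitClosure_apply (hT : Isometry T) (x y : Y) :
    Metric.infDist (T y) (orbitClosure T x) = Metric.infDist y (orbitClosure T x) := by
  have hne : (orbitClosure T x).Nonempty := ⟨x, self_mem_orbitClosure x⟩
  have hle : ∀ z, Metric.infDist (T z) (orbitClosure T x) ≤ Metric.infDist z (orbitClosure T x) :=
    fun z => (Metric.le_infDist hne).2 fun {c} hc =>
      (Metric.infDist_le_dist_of_mem (mapsTo_orbitClosure hT.continuous x hc)).trans_eq
        (hT.dist_eq z c)
  have hle' : ∀ n z, Metric.infDist (T^[n] z) (orbitClosure T x)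
      ≤ Metric.infDist z (orbitClosure T x) := by
    intro n
    induction n with
    | zero => exact fun z => le_rfl
    | succ n ih => exact fun z => (ih (T z)).trans (hle z)
  -- The distance never increases along an orbit, and recurrence brings `y` back near itself, so the
  -- first step cannot decrease it either.
  refine (hle y).antisymm (le_of_forall_pos_le_add fun ε hε => ?_)
  obtain ⟨n, hn, h1⟩ := ((hT.frequently_dist_iterate_lt y hε).and_eventually
    (eventually_ge_atTop 1)).exists
  obtain ⟨m, rfl⟩ := Nat.exists_eq_add_of_le' h1
  have h2 : Metric.infDist y (orbitClosure T x) ≤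
      Metric.infDist (T^[m + 1] y) (orbitClosure T x) + dist y (T^[m + 1] y) :=
    Metric.infDist_le_infDist_add_dist
  have h3 := hle' m (T y)
  rw [iterate_succ_apply] at h2 hn
  rw [dist_comm] at hn
  linarith

variable [MeasurableSpace Y] [BorelSpace Y]

/-- Each point lies in the support of an invariant probability measure of an isometry. -/
theorem exists_invariant_measure_pos_nhds (hT : Isometry T) (x : Y) :
    ∃ μ : Measure Y, IsProbabilityMeasure μ ∧ MeasurePreserving T μ μ ∧
      ∀ U : Set Y, IsOpen U → x ∈ U → 0 < μ U := by
  have hC : IsClosed (orbitClosure T x) := isClosed_closure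
  have : CompactSpace (orbitClosure T x) := isCompact_iff_compactSpace.1 hC.isCompact
  let x' : orbitClosure T x := ⟨x, self_mem_orbitClosure x⟩
  have : Nonempty (orbitClosure T x) := ⟨x'⟩
  have hmap := mapsTo_orbitClosure hT.continuous x
  obtain ⟨ν, hν, hinv⟩ := exists_isProbabilityMeasure_measurePreserving
    (hT.continuous.restrict hmap)
  have hval : Measurable (Subtype.val : orbitClosure T x → Y) := measurable_subtype_coe
  refine ⟨ν.map Subtype.val, Measure.isProbabilityMeasure_map hval.aemeasurable,
    ⟨hT.continuous.measurable, ?_⟩, fun U hU hxU => ?_⟩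
  · rw [Measure.map_map hT.continuous.measurable hval]
    conv_rhs => rw [← hinv.map_eq]
    rw [Measure.map_map hval hinv.measurable]
    rfl
  · rw [Measure.map_apply hval hU.measurableSet]
    exact (isMinimalMap_restrict_orbitClosure hT x).measure_pos hinv
      (IsProbabilityMeasure.ne_zero ν) (hU.preimage continuous_subtype_val) ⟨x', hxU⟩

/-- An isometry of a compact metric space has a finite invariant measure of full support. -/
theorem exists_invariant_measure_full_support (hT : Isometry T) :
    ∃ μ : Measure Y, IsFiniteMeasure μ ∧ MeasurePreserving T μ μ ∧
      ∀ U : Set Y, IsOpen U → U.Nonempty → 0 < μ U := by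
  rcases isEmpty_or_nonempty Y with hY | hY
  · exact ⟨0, inferInstance, ⟨hT.continuous.measurable, by simp⟩,
      fun U _ ⟨y, _⟩ => hY.elim y⟩
  choose ν hν hinv hpos using exists_invariant_measure_pos_nhds hT
  -- Summable positive weights keep the mixture over a dense sequence finite.
  obtain ⟨c, hc, hsum⟩ := ENNReal.exists_pos_sum_of_countable' one_ne_zero ℕ
  let z := TopologicalSpace.denseSeq Y
  refine ⟨Measure.sum fun n => c n • ν (z n), ⟨?_⟩, ⟨hT.continuous.measurable, ?_⟩, ?_⟩
  · rw [Measure.sum_apply _ MeasurableSet.univ]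
    simpa using hsum.trans ENNReal.one_lt_top
  · rw [Measure.map_sum hT.continuous.aemeasurable]
    congr 1
    ext1 n
    rw [Measure.map_smul, (hinv _).map_eq]
  · intro U hU hne
    obtain ⟨n, hn⟩ := (TopologicalSpace.denseRange_denseSeq Y).exists_mem_open hU hne
    calc 0 < c n * ν (z n) U := ENNReal.mul_pos (hc n).ne' (hpos _ U hU hn).ne'
      _ ≤ _ := Measure.le_sum_apply _ _ |>.trans' (ENNReal.le_tsum (f := fun n => (c n • ν (z n)) U) n)

/-- If an isometry of a compact space is ergodic for every finite invariant measure of full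
support, then it is minimal. -/
theorem isMinimalMap_of_forall_ergodic (hT : Isometry T)
    (h : ∀ μ : Measure Y, IsFiniteMeasure μ → MeasurePreserving T μ μ →
      (∀ U : Set Y, IsOpen U → U.Nonempty → 0 < μ U) → Ergodic T μ) : IsMinimalMap T := by
  obtain ⟨μ, hfin, hinv, hpos⟩ := exists_invariant_measure_full_support hT
  have herg := h μ hfin hinv hpos
  intro x z
  by_contra hz
  have hne : (orbitClosure T x).Nonempty := ⟨x, self_mem_orbitClosure x⟩
  let d : Y → ℝ := fun y => Metric.infDist y (orbitClosure T x)
  have hd : Continuous d := Metric.continuous_infDist_pt _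
  have hdz : 0 < d z :=
    (isClosed_closure.notMem_iff_infDist_pos hne).1 hz
  have hdx : d x = 0 := Metric.infDist_zero_of_mem (self_mem_orbitClosure x)
  have hopen : IsOpen {y | d y < d z / 2} := isOpen_lt hd continuous_const
  have hpre : T ⁻¹' {y | d y < d z / 2} = {y | d y < d z / 2} := by
    ext y
    simp only [mem_preimage, mem_ofPred_eq, d, infDist_orbitClosure_apply hT]
  rcases herg.measure_self_or_compl_eq_zero hopen.measurableSet hpre with h0 | h0
  · refine (hpos _ hopen ⟨x, ?_⟩).ne' h0
    simp only [mem_ofPred_eq, hdx]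
    linarith
  · refine (hpos {y | d z / 2 < d y} (isOpen_lt continuous_const hd) ⟨z, ?_⟩).ne'
      (measure_mono_null ?_ h0)
    · simp only [mem_ofPred_eq]
      linarith
    · intro y hy
      simp only [mem_compl_iff, mem_ofPred_eq, not_lt] at hy ⊢
      exact hy.le

/-- Two probability measures invariant under a minimal isometry agree on balls. -/
theorem IsMinimalMap.measure_ball_eq [IsUltrametricDist Y] (hmin : IsMinimalMap T)
    (hT : Isometry T)
    {μ ν : Measure Y} [IsProbabilityMeasure μ] [IsProbabilityMeasure ν]
    (hμ : MeasurePreserving T μ μ) (hν : MeasurePreserving T ν ν) (x : Y) {r : ℝ} (hr : 0 < r) :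
    μ (Metric.ball x r) = ν (Metric.ball x r) := by
  have hconst : ∀ {m : Measure Y}, MeasurePreserving T m m → ∀ y,
      m (Metric.ball y r) = m (Metric.ball x r) := by
    intro m hm y
    -- In an ultrametric space the ball about `y` is also the ball about the orbit point `T^[n] x`
    -- inside it, whose preimage under `T^[n]` is the ball about `x`.
    obtain ⟨_, hn, n, rfl⟩ := (hmin x).inter_open_nonempty (Metric.ball y r) Metric.isOpen_ball
      ⟨y, Metric.mem_ball_self hr⟩
    rw [IsUltrametricDist.ball_eq_of_mem hn,
      ← (hm.iterate n).measure_preimage Metric.isOpen_ball.nullMeasurableSet,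
      (hT.iterate n).preimage_ball]
  -- Slicing this symmetric set in either direction gives balls of radius `r`, of constant mass.
  have hmeas : MeasurableSet {p : Y × Y | dist p.2 p.1 < r} :=
    (isOpen_lt (by fun_prop) continuous_const).measurableSet
  have h1 : (ν.prod μ) {p : Y × Y | dist p.2 p.1 < r} = μ (Metric.ball x r) := by
    rw [Measure.prod_apply hmeas, ← mul_one (μ (Metric.ball x r)), ← measure_univ (μ := ν),
      ← lintegral_const]
    exact lintegral_congr fun y => hconst hμ y
  have h2 : (ν.prod μ) {p : Y × Y | dist p.2 p.1 < r} = ν (Metric.ball x r) := by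
    rw [Measure.prod_apply_symm hmeas, ← mul_one (ν (Metric.ball x r)), ← measure_univ (μ := μ),
      ← lintegral_const]
    refine lintegral_congr fun y => (congrArg ν ?_).trans (hconst hν y)
    ext z
    simp [dist_comm]
  rw [← h1, h2]

/-- A minimal isometry of a nonempty compact ultrametric space is uniquely ergodic. -/
theorem IsMinimalMap.isUniquelyErgodic [IsUltrametricDist Y] [Nonempty Y] (hmin : IsMinimalMap T)
    (hT : Isometry T) : IsUniquelyErgodic T := by
  obtain ⟨μ, hμ, hinv⟩ := exists_isProbabilityMeasure_measurePreserving hT.continuous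
  refine ⟨μ, ⟨hμ, hinv⟩, ?_⟩
  rintro ν ⟨hν, hνinv⟩
  have hbasis : TopologicalSpace.IsTopologicalBasis
      {s : Set Y | ∃ x r, 0 < r ∧ s = Metric.ball x r} := by
    refine TopologicalSpace.isTopologicalBasis_of_isOpen_of_nhds ?_ ?_
    · rintro _ ⟨x, r, _, rfl⟩
      exact Metric.isOpen_ball
    · intro a u ha hu
      obtain ⟨r, hr, hsub⟩ := Metric.isOpen_iff.1 hu a ha
      exact ⟨_, ⟨a, r, hr, rfl⟩, Metric.mem_ball_self hr, hsub⟩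
  refine ext_of_generate_finite _ (BorelSpace.measurable_eq.trans hbasis.borel_eq_generateFrom)
    ?_ ?_ (by simp)
  -- Balls form a π-system: two that meet are concentric about any common point.
  · rintro _ ⟨x, r, hr, rfl⟩ _ ⟨y, s, hs, rfl⟩ ⟨z, hzx, hzy⟩
    refine ⟨z, min r s, lt_min hr hs, ?_⟩
    rw [IsUltrametricDist.ball_eq_of_mem hzx, IsUltrametricDist.ball_eq_of_mem hzy]
    ext
    simp
  · rintro _ ⟨x, r, hr, rfl⟩
    exact hmin.measure_ball_eq hT hνinv hinv x hr

end Compact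

/-- For a self-map of a nonempty compact space that is embedded in an ultrametric space so that the
map becomes an isometry, minimality, unique ergodicity, and ergodicity of all finite invariant
measures of full support are equivalent. -/
theorem tfae_of_isEmbedding {Y M : Type*} [TopologicalSpace Y] [CompactSpace Y] [Nonempty Y]
    [MeasurableSpace Y] [BorelSpace Y] [MetricSpace M] [IsUltrametricDist M] {T : Y → Y}
    {e : Y → M} (he : IsEmbedding e) (hT : ∀ x y, dist (e (T x)) (e (T y)) = dist (e x) (e y)) :
    [ IsMinimalMap T,
      IsUniquelyErgodic T,
      ∀ μ : Measure Y, IsFiniteMeasure μ → MeasurePreserving T μ μ →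
        (∀ U : Set Y, IsOpen U → U.Nonempty → 0 < μ U) → Ergodic T μ ].TFAE := by
  let : MetricSpace Y := he.comapMetricSpace e
  have : IsUltrametricDist Y := ⟨fun x y z => dist_triangle_max (e x) (e y) (e z)⟩
  have hiso : Isometry T := Isometry.of_dist_eq hT
  tfae_have 1 → 2 := fun h => h.isUniquelyErgodic hiso
  tfae_have 2 → 3 := fun h _ _ hμ _ => h.ergodic hμ
  tfae_have 3 → 1 := isMinimalMap_of_forall_ergodic hiso
  tfae_finish

theorem IsDisc.isOpen {K : Type*} [NontriviallyNormedField K] [IsUltrametricDist K] {U : Set K}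
    (hU : IsDisc U) : IsOpen U := by
  rcases hU with rfl | ⟨c, r, hr, rfl | rfl⟩
  · exact isOpen_univ
  · exact Metric.isOpen_ball
  · exact IsUltrametricDist.isOpen_closedBall c hr.ne'

/-! ### Continuity of convergent power series. -/

section Continuity

variable {K : Type*} [NontriviallyNormedField K] [IsUltrametricDist K] [CompleteSpace K]

/-- A power series over a complete non-Archimedean field that converges at `a` is continuous on the
closed disc about its centre through `a`. -/
theorem continuousOn_value_closedBall {F : PowerSeries K} {c a : K} (h : ConvergesAt F c a) :
    ContinuousOn (value F c) (Metric.closedBall c (dist a c)) := by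
  have hterm : ∀ x ∈ Metric.closedBall c (dist a c), ∀ n : ℕ,
      ‖PowerSeries.coeff n F * (x - c) ^ n‖ ≤ ‖PowerSeries.coeff n F * (a - c) ^ n‖ := by
    intro x hx n
    rw [Metric.mem_closedBall, dist_eq_norm, dist_eq_norm] at hx
    rw [norm_mul, norm_mul, norm_pow, norm_pow]
    gcongr
  have hconv : ∀ x ∈ Metric.closedBall c (dist a c), ConvergesAt F c x := by
    intro x hx
    refine NonarchimedeanAddGroup.summable_of_tendsto_cofinite_zero ?_
    exact squeeze_zero_norm (hterm x hx) (tendsto_zero_iff_norm_tendsto_zero.1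
      (Summable.tendsto_cofinite_zero h))
  have hunif : TendstoUniformlyOn
      (fun (N : ℕ) (x : K) => ∑ n ∈ Finset.range N, PowerSeries.coeff n F * (x - c) ^ n)
      (value F c) atTop (Metric.closedBall c (dist a c)) := by
    refine Metric.tendstoUniformlyOn_iff.2 fun ε hε => ?_
    have hlim := (tendsto_zero_iff_norm_tendsto_zero.1
      (Summable.tendsto_atTop_zero h)).eventually_lt_const (half_pos hε)
    obtain ⟨N₀, hN₀⟩ := eventually_atTop.1 hlim
    filter_upwards [eventually_ge_atTop N₀] with N hN x hx
    -- The ultrametric inequality bounds the tail by its largest term, which is dominated by the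
    -- terms at `a`, uniformly in `x`.
    rw [value, ← (hconv x hx).sum_add_tsum_nat_add N, dist_eq_norm, add_sub_cancel_left]
    refine (IsUltrametricDist.norm_tsum_le_of_forall_le fun n => ?_).trans_lt (half_lt_self hε)
    exact (hterm x hx _).trans (hN₀ (n + N) (by omega)).le
  exact hunif.continuousOn (Eventually.of_forall fun N => by fun_prop).frequently

/-- A power series converging on an open set that contains its centre is continuous there. -/
theorem continuousOn_value {F : PowerSeries K} {c : K} {U : Set K} (hU : IsOpen U) (hc : c ∈ U)
    (h : ∀ x ∈ U, ConvergesAt F c x) : ContinuousOn (value F c) U := by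
  intro x hx
  obtain ⟨a, haU, hac, hxa⟩ : ∃ a ∈ U, a ≠ c ∧ dist x c ≤ dist a c := by
    -- At the centre the disc through `x` has radius 0, so another point of `U` is needed; `K` has
    -- no isolated points.
    by_cases hxc : x = c
    · subst hxc
      have hev : ∀ᶠ a in 𝓝[≠] x, a ∈ U := mem_nhdsWithin_of_mem_nhds (hU.mem_nhds hc)
      obtain ⟨a, haU, ha⟩ := (hev.and self_mem_nhdsWithin).exists
      exact ⟨a, haU, ha, by simp⟩
    · exact ⟨x, hx, hxc, le_rfl⟩
  have hnhds : Metric.closedBall c (dist a c) ∈ 𝓝 x :=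
    (IsUltrametricDist.isOpen_closedBall c (dist_pos.2 hac).ne').mem_nhds hxa
  exact ((continuousOn_value_closedBall (h a haU)).continuousAt hnhds).continuousWithinAt

end Continuity

end NonArchDynamics

/-! ### Transfer to `f` and to multiplication through `g`. -/

theorem theoremH {K : Type*} [NontriviallyNormedField K] [IsUltrametricDist K] [CompleteSpace K]
    [MeasurableSpace K] [BorelSpace K]
    (f : PowerSeries K) (x₀ : K) (D : Set K) (hD : NonArchDynamics.IsLinearizationDisc f x₀ D)
    (g : PowerSeries K) (hg₀ : PowerSeries.coeff 0 g = 0) (hg₁ : ‖PowerSeries.coeff 1 g‖ = 1)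
    (hg : NonArchDynamics.ConjugatesOn f g x₀ D)
    (X : Set K) (hXD : X ⊆ D) (hXne : X.Nonempty) (hXc : IsCompact X)
    (hX : Set.MapsTo (NonArchDynamics.value f x₀) X X) :
    [ NonArchDynamics.IsMinimalMap
        (Set.MapsTo.restrict (fun y : K => PowerSeries.coeff 1 f * y)
          (NonArchDynamics.value g x₀ '' X) (NonArchDynamics.value g x₀ '' X)
          (hg.mapsTo_mul hXD hX)),
      NonArchDynamics.IsMinimalMap
        (Set.MapsTo.restrict (NonArchDynamics.value f x₀) X X hX),
      NonArchDynamics.IsUniquelyErgodic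
        (Set.MapsTo.restrict (NonArchDynamics.value f x₀) X X hX),
      ∀ μ : MeasureTheory.Measure X, MeasureTheory.IsFiniteMeasure μ →
        MeasureTheory.MeasurePreserving
          (Set.MapsTo.restrict (NonArchDynamics.value f x₀) X X hX) μ μ →
        (∀ U : Set X, IsOpen U → U.Nonempty → 0 < μ U) →
        Ergodic (Set.MapsTo.restrict (NonArchDynamics.value f x₀) X X hX) μ ].TFAE := by
  obtain ⟨hind, g₁, -, -, ⟨hdisc, hx₀, -⟩, -⟩ := hD
  have : CompactSpace X := isCompact_iff_compactSpace.1 hXc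
  have : Nonempty X := hXne.to_subtype
  have hcont : Continuous fun x : X => NonArchDynamics.value g x₀ x :=
    ((NonArchDynamics.continuousOn_value hdisc.isOpen hx₀ hg.conv_g).mono hXD).domRestrict
  have hinj : Set.InjOn (NonArchDynamics.value g x₀) X := hg.injOn.mono hXD
  have hdyn := NonArchDynamics.tfae_of_isEmbedding
    (T := Set.MapsTo.restrict (NonArchDynamics.value f x₀) X X hX)
    (hcont.isClosedEmbedding hinj.injective).isEmbedding fun x y => by
      simp only [Set.MapsTo.val_restrict_apply, hg.schroeder _ (hXD x.2),
        hg.schroeder _ (hXD y.2), dist_eq_norm, ← mul_sub, norm_mul, hind.indifferent, one_mul]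
  let e : X ≃ₜ NonArchDynamics.value g x₀ '' X :=
    Continuous.homeoOfEquivCompactToT2 (f := Equiv.Set.imageOfInjOn _ X hinj)
      (hcont.subtype_mk _)
  have hsemi : Function.Semiconj e (Set.MapsTo.restrict (NonArchDynamics.value f x₀) X X hX)
      (Set.MapsTo.restrict (fun y : K => PowerSeries.coeff 1 f * y) _ _ (hg.mapsTo_mul hXD hX)) :=
    fun x => Subtype.ext (hg.schroeder x (hXD x.2))
  tfae_have 1 → 2 := fun h => h.of_semiconj e.symm.continuous e.symm.surjective
    (hsemi.inverse_left e.symm_apply_apply e.apply_symm_apply)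
  tfae_have 2 → 1 := fun h => h.of_semiconj e.continuous e.surjective hsemi
  tfae_have 2 ↔ 3 := hdyn.out 0 1
  tfae_have 3 ↔ 4 := hdyn.out 1 2
  tfae_finish
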